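/- Let $Z$ be a real or complex separable infinite-dimensional Banach space containing a complemented copy of a Banach space with a sub-symmetric basis. That is, some complemented subspace of $Z$ (the range of a bounded projection on $Z$) is isomorphic to a Banach space $E$ that has an unconditional Schauder basis $(e_n)_{n\ge 0}$ equivalent to each of its subsequences: for every strictly increasing sequence $(n_k)_{k\ge 0}$ of non-negative integers and every sequence $(a_k)_{k\ge 0}$ of scalars, $\sum_k a_k e_k$ converges if and only if $\sum_k a_k e_{n_k}$ converges. Then there is a bounded linear operator $A$ on $Z$ which is universal for ergodic systems: for every ergodic (not necessarily invertible) measure-preserving transformation $T$ of a standard Lebesgue probability space $(X,\mathcal B,\mu)$ (a standard Borel space with an atomless Borel probability measure), there is an $A$-invariant Borel probability measure $\nu$ on $Z$ with full support (that is, $\nu(U)>0$ for every non-empty open $U\subseteq Z$) such that the systems $(X,\mathcal B,\mu;T)$ and $(Z,\mathcal B_Z,\nu;A)$ are isomorphic, where $\mathcal B_Z$ is the Borel $\sigma$-field of $Z$. Here isomorphic means that there are measure-preserving maps $\Phi:X\to Z$ and $\Psi:Z\to X$ with $\Psi\circ\Phi=\mathrm{id}$ $\mu$-almost everywhere, $\Phi\circ\Psi=\mathrm{id}$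 $\nu$-almost everywhere, and $\Phi\circ T=A\circ\Phi$ $\mu$-almost everywhere. -/

import Mathlib

open MeasureTheory Filter Topology

universe v u w t

/-- Two sequences `x`, `y` of vectors are equivalent if, for every sequence of scalars `a`, the
series `∑ aₙ xₙ` converges if and only if the series `∑ aₙ yₙ` converges (convergence of the
ordered partial sums). -/
def EquivalentSeq (𝕜 : Type*) {E F : Type*} [RCLike 𝕜]
    [NormedAddCommGroup E] [NormedSpace 𝕜 E] [NormedAddCommGroup F] [NormedSpace 𝕜 F]
    (x : ℕ → E) (y : ℕ → F) : Prop :=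
  ∀ a : ℕ → 𝕜,
    (∃ s : E, Tendsto (fun N => ∑ n ∈ Finset.range N, a n • x n) atTop (𝓝 s)) ↔
      (∃ t : F, Tendsto (fun N => ∑ n ∈ Finset.range N, a n • y n) atTop (𝓝 t))

/-- An unconditional Schauder basis is sub-symmetric if it is equivalent to each of its
subsequences. -/
def IsSubsymmetric {𝕜 E : Type*} [RCLike 𝕜] [NormedAddCommGroup E] [NormedSpace 𝕜 E]
    (e : UnconditionalSchauderBasis ℕ 𝕜 E) : Prop :=
  ∀ φ : ℕ → ℕ, StrictMono φ → EquivalentSeq 𝕜 (fun n => e n) (fun n => e (φ n))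

/-- `E` is a space with a sub-symmetric basis. -/
def HasSubsymmetricBasis (𝕜 E : Type*) [RCLike 𝕜] [NormedAddCommGroup E] [NormedSpace 𝕜 E] :
    Prop :=
  ∃ e : UnconditionalSchauderBasis ℕ 𝕜 E, IsSubsymmetric e

/-- `Z` contains a complemented copy of `E`: some (closed) subspace of `Z` which is the range of a
bounded projection is isomorphic to `E`. -/
def ContainsComplementedCopy (𝕜 Z E : Type*) [RCLike 𝕜] [NormedAddCommGroup Z] [NormedSpace 𝕜 Z]
    [NormedAddCommGroup E] [NormedSpace 𝕜 E] : Prop :=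
  ∃ W : Submodule 𝕜 Z, W.ClosedComplemented ∧ Nonempty (W ≃L[𝕜] E)

/-- The measure-preserving systems `(X, μ; T)` and `(Y, ν; S)` are isomorphic: there are
measure-preserving maps `Φ : X → Y` and `Ψ : Y → X`, inverse to each other up to null sets, with
`Φ ∘ T = S ∘ Φ` almost everywhere. -/
def IsomorphicSystems {X Y : Type*} [MeasurableSpace X] [MeasurableSpace Y]
    (μ : Measure X) (T : X → X) (ν : Measure Y) (S : Y → Y) : Prop :=
  ∃ (Φ : X → Y) (Ψ : Y → X), MeasurePreserving Φ μ ν ∧ MeasurePreserving Ψ ν μ ∧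
    (∀ᵐ x ∂μ, Ψ (Φ x) = x) ∧ (∀ᵐ y ∂ν, Φ (Ψ y) = y) ∧ (∀ᵐ x ∂μ, Φ (T x) = S (Φ x))

/-- A bounded operator `A` on `Z` is universal for ergodic systems if every ergodic system
`(X, μ; T)` (invertible or not) on a standard Lebesgue probability space, that is, a standard Borel
space with an atomless Borel probability measure, is isomorphic to `(Z, ν; A)` for some
`A`-invariant Borel probability measure `ν` on `Z` with full support. -/
def IsUniversalForErgodicSystems {𝕜 : Type u} {Z : Type w} [RCLike 𝕜]
    [NormedAddCommGroup Z] [NormedSpace 𝕜 Z] [MeasurableSpace Z] [BorelSpace Z]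
    (A : Z →L[𝕜] Z) : Prop :=
  ∀ (X : Type v) [MeasurableSpace X] [StandardBorelSpace X]
    (μ : Measure X) [IsProbabilityMeasure μ] [NullSingletonClass μ] (T : X → X), Ergodic T μ →
    ∃ ν : Measure Z, IsProbabilityMeasure ν ∧ ν.IsOpenPosMeasure ∧ MeasurePreserving A ν ν ∧
      IsomorphicSystems μ T ν A

/-!
An ergodic system is coded by summing vectors along its orbits. Call a sequence `ζ` in `Z` with
`A (ζ 0) = 0`, `A (ζ (n + 1)) = ζ n` and `‖ζ n‖ = O(2⁻ⁿ)` a backward orbit of `A`. If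
`x ↦ ξ x` is a measurable map from `X` to backward orbits with integrable constants, then
`Φ x = ∑ n, ξ (T^[n] x) n` converges almost everywhere and `Φ (T x) = A (Φ x)`. Only forward
iterates of `T` are used, so `T` need not be invertible. The measure `ν` is the image of `μ` under
`Φ`, so it remains to choose `ξ` such that `Φ` is injective on a set of full measure and the image
measure has full support (`exists_factor_map`).

Full support: suppose that the vectors `ζ n`, for `ζ` a backward orbit, span a dense subspace. Then
the finite sums `∑ n < N, ζ n n` with backward orbits `ζ 0, ζ 1, …` are dense; enumerate a dense
sequence of them so that each occurs infinitely often. The `k`-th target is realised on a tower of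
height `N k` over a set `C k` whose first `N k` preimages are disjoint: on level `n` of the tower,
`ξ` is close to the backward orbit `ζ n`. The heights can be fixed in advance, and the bases are
then chosen so small, one after another, that the later towers are negligible compared with the
base of each earlier one (`exists_tower_bases`). This uses only that an ergodic transformation of an
atomless space is aperiodic (`measure_setOf_iterate_eq_self`).

Injectivity: each `ξ x` is perturbed by `s x • w`, where `w` is one more backward orbit, and
`s : X → ℝ` is injective and tends to zero along the sequence of towers. There are functionals `θ i`
which see only the zeroth term of the backward orbits used; almost all of them vanish on any of the
unperturbed orbits, but none of them vanishes on `w 0`. Hence `Φ x` determines `s x`, and so `x`.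

The operator: write `Z` as the sum of a copy of `E`, with sub-symmetric basis `e`, and of a closed
subspace `K`. Sub-symmetry and unconditionality give a bounded backward shift
`e (2 * m + 1) ↦ e m`, `e (2 * m) ↦ 0` and a bounded right inverse of it
(`IsSubsymmetric.exists_shifts`). Its orbits start at the vectors with even index. The operator
`A` is a large multiple of the backward shift, plus a nuclear operator sending `e (4 * i + 2)` to a
small multiple of the `i`-th member of a dense sequence in `K`. The orbits starting at `e (4 * i)`
and those starting in `K` together have a dense span, the coordinate functionals at `4 * i` serve as
`θ i`, and `w` starts at an infinite combination of the vectors `e (4 * i)`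
(`exists_isUniversal_of_retract`).
-/

open scoped ENNReal NNReal

/-! ### Disjoint preimages in atomless ergodic systems -/

section Ergodic

variable {X : Type*} [MeasurableSpace X]

theorem exists_measurableSet_pos_le [StandardBorelSpace X] (μ : Measure X)
    [IsProbabilityMeasure μ] [NullSingletonClass μ] {η : ℝ≥0∞} (hη : 0 < η) :
    ∃ D : Set X, MeasurableSet D ∧ 0 < μ D ∧ μ D ≤ η := by
  let _ := upgradeStandardBorel X
  have h : ∀ x : X, ∃ U : Set X, x ∈ U ∧ IsOpen U ∧ μ U < η := fun x => by
    obtain ⟨U, hU, hUo, hμ⟩ := Set.exists_isOpen_lt_of_lt ({x} : Set X) η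
      (by rwa [measure_singleton (μ := μ) x])
    exact ⟨U, hU rfl, hUo, hμ⟩
  choose U hxU hUo hU using h
  obtain ⟨s, hs, hcov⟩ := TopologicalSpace.countable_cover_nhds fun x => (hUo x).mem_nhds (hxU x)
  by_contra! H
  have h0 : ∀ x ∈ s, μ (U x) = 0 := fun x _ => by
    by_contra hx
    exact (H (U x) (hUo x).measurableSet (pos_iff_ne_zero.2 hx)).not_ge (hU x).le
  have := (measure_biUnion_null_iff hs).2 h0
  rw [hcov, measure_univ] at this
  exact one_ne_zero this

/-- An ergodic transformation of an atomless space is aperiodic: otherwise almost every point would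
have period `i`, and the orbit of a set of measure less than `1 / i` would be a non-trivial
invariant set. -/
theorem measure_setOf_iterate_eq_self [StandardBorelSpace X] {μ : Measure X}
    [IsProbabilityMeasure μ] [NullSingletonClass μ] {T : X → X} (hT : Ergodic T μ) {i : ℕ}
    (hi : 0 < i) : μ {x | T^[i] x = x} = 0 := by
  have hTm := hT.measurable
  have hPm : MeasurableSet {x | T^[i] x = x} :=
    measurableSet_eq_fun (hTm.iterate i) measurable_id
  have hP : {x | T^[i] x = x} ≤ᵐ[μ] T ⁻¹' {x | T^[i] x = x} := by
    refine Eventually.of_forall fun x (hx : T^[i] x = x) => ?_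
    change T^[i] (T x) = T x
    rw [← Function.iterate_succ_apply, Function.iterate_succ_apply', hx]
  rcases hT.ae_empty_or_univ_of_ae_le_preimage hPm.nullMeasurableSet hP with h | h
  · rw [measure_congr h, measure_empty]
  exfalso
  have hper : ∀ᵐ x ∂μ, T^[i] x = x := by
    filter_upwards [h] with x hx
    exact hx.mpr trivial
  obtain ⟨D, hDm, hD0, hD⟩ := exists_measurableSet_pos_le μ (η := 2⁻¹ * (i : ℝ≥0∞)⁻¹) (by simp)
  have hUm : MeasurableSet (⋃ a ∈ Finset.range i, T^[a] ⁻¹' D) :=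
    Finset.measurableSet_biUnion _ fun a _ => hTm.iterate a hDm
  have hinv : T ⁻¹' (⋃ a ∈ Finset.range i, T^[a] ⁻¹' D) ≤ᵐ[μ]
      (⋃ a ∈ Finset.range i, T^[a] ⁻¹' D) := by
    filter_upwards [hper] with x hx hxU
    have hxU : x ∈ T ⁻¹' (⋃ a ∈ Finset.range i, T^[a] ⁻¹' D) := hxU
    change x ∈ (⋃ a ∈ Finset.range i, T^[a] ⁻¹' D)
    simp only [Set.mem_preimage, Set.mem_iUnion, Finset.mem_range, exists_prop] at hxU ⊢
    obtain ⟨a, ha, hxa⟩ := hxU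
    rw [← Function.iterate_succ_apply] at hxa
    rcases eq_or_lt_of_le (Nat.succ_le_of_lt ha) with h | h
    · refine ⟨0, hi, ?_⟩
      rw [h, hx] at hxa
      exact hxa
    · exact ⟨a + 1, h, hxa⟩
  have hμU : μ (⋃ a ∈ Finset.range i, T^[a] ⁻¹' D) ≤ 2⁻¹ := by
    calc μ (⋃ a ∈ Finset.range i, T^[a] ⁻¹' D) ≤ ∑ a ∈ Finset.range i, μ (T^[a] ⁻¹' D) :=
          measure_biUnion_finset_le _ _
      _ = i * μ D := by
          simp [(hT.toMeasurePreserving.iterate _).measure_preimage hDm.nullMeasurableSet]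
      _ ≤ i * (2⁻¹ * (i : ℝ≥0∞)⁻¹) := by gcongr
      _ = 2⁻¹ := by
          rw [mul_left_comm, ENNReal.mul_inv_cancel (by simpa using hi.ne') (by simp), mul_one]
  rcases hT.ae_empty_or_univ_of_preimage_ae_le hUm.nullMeasurableSet hinv with h | h
  · have h0 : μ (⋃ a ∈ Finset.range i, T^[a] ⁻¹' D) = 0 := by rw [measure_congr h, measure_empty]
    refine hD0.ne' (measure_mono_null ?_ h0)
    exact Set.subset_biUnion_of_mem (u := fun a => T^[a] ⁻¹' D) (Finset.mem_range.2 hi)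
  · rw [measure_congr h, measure_univ] at hμU
    have : (2⁻¹ : ℝ≥0∞) < 1 := by simp
    exact this.not_ge hμU

/-- A weak form of the Rokhlin lemma, without any lower bound on the measure of the tower: there
are arbitrarily small sets of positive measure whose first `N` preimages are disjoint. -/
theorem exists_disjoint_preimages [StandardBorelSpace X] {μ : Measure X}
    [IsProbabilityMeasure μ] [NullSingletonClass μ] {T : X → X} (hT : Ergodic T μ) (N : ℕ)
    {η : ℝ≥0∞} (hη : 0 < η) :
    ∃ C : Set X, MeasurableSet C ∧ 0 < μ C ∧ μ C ≤ η ∧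
      ∀ i, 0 < i → i < N → Disjoint C (T^[i] ⁻¹' C) := by
  induction N with
  | zero =>
    obtain ⟨D, h1, h2, h3⟩ := exists_measurableSet_pos_le μ hη
    exact ⟨D, h1, h2, h3, fun i _ hi => absurd hi (Nat.not_lt_zero i)⟩
  | succ N ih =>
    obtain ⟨C, hCm, hC0, hCη, hC⟩ := ih
    rcases N.eq_zero_or_pos with rfl | hN
    · exact ⟨C, hCm, hC0, hCη, fun i h0 h1 => by omega⟩
    let _ := upgradeStandardBorel X
    set 𝓑 := TopologicalSpace.countableBasis X
    have h𝓑 := TopologicalSpace.isBasis_countableBasis X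
    have hcov : C \ {x | T^[N] x = x} ⊆ ⋃ U ∈ 𝓑, C ∩ (U \ T^[N] ⁻¹' U) := by
      rintro x ⟨hxC, hx⟩
      obtain ⟨U, hU, hxU, hUs⟩ := h𝓑.exists_subset_of_mem_open
        (show x ∈ ({T^[N] x}ᶜ : Set X) from fun h => hx (Eq.symm h)) isOpen_compl_singleton
      simp only [Set.mem_iUnion]
      exact ⟨U, hU, hxC, hxU, fun h => hUs h rfl⟩
    have hpos : μ (⋃ U ∈ 𝓑, C ∩ (U \ T^[N] ⁻¹' U)) ≠ 0 := by
      intro h0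
      have := measure_mono_null hcov h0
      rw [measure_sdiff_null (measure_setOf_iterate_eq_self hT hN)] at this
      exact hC0.ne' this
    have : ∃ U ∈ 𝓑, μ (C ∩ (U \ T^[N] ⁻¹' U)) ≠ 0 := by
      by_contra! H
      exact hpos ((measure_biUnion_null_iff (TopologicalSpace.countable_countableBasis X)).2 H)
    obtain ⟨U, hU, hμU⟩ := this
    have hUm : MeasurableSet U := (h𝓑.isOpen hU).measurableSet
    refine ⟨C ∩ (U \ T^[N] ⁻¹' U), hCm.inter (hUm.diff (hT.measurable.iterate N hUm)),
      pos_iff_ne_zero.2 hμU, (measure_mono Set.inter_subset_left).trans hCη, fun i hi hiN => ?_⟩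
    rcases eq_or_lt_of_le (Nat.lt_succ_iff.1 hiN) with rfl | hiN
    · exact Set.disjoint_left.2 fun x hx hx' => hx.2.2 hx'.2.1
    · exact (hC i hi hiN).mono Set.inter_subset_left
        (Set.preimage_mono Set.inter_subset_left)

/-- A sequence of tower bases `C k` of heights `N k`, chosen so that the towers after the `k`-th
one, weighted by `M`, are negligible compared with the `k`-th base. -/
theorem exists_tower_bases [StandardBorelSpace X] {μ : Measure X}
    [IsProbabilityMeasure μ] [NullSingletonClass μ] {T : X → X} (hT : Ergodic T μ) (M : ℕ → ℝ≥0)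
    (N : ℕ → ℕ) (hM : ∀ k, 1 ≤ M k) (hN : ∀ k, 1 ≤ N k) :
    ∃ C : ℕ → Set X, (∀ k, MeasurableSet (C k)) ∧
      (∀ k i, 0 < i → i < N k → Disjoint (C k) (T^[i] ⁻¹' C k)) ∧
      ∀ k, 2 * ∑' i, M (k + 1 + i) * (N (k + 1 + i) * μ (C (k + 1 + i))) <
        2⁻¹ ^ N k * μ (C k) := by
  choose! C hCm hC0 hCη hC using fun (k : ℕ) (η : ℝ≥0∞) (hη : 0 < η) =>
    exists_disjoint_preimages hT (N k) hη
  -- The bounds `η` on the measures are defined recursively: `η (k + 1)` makes the weighted measure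
  -- of the next tower at most one eighth of `2⁻¹ ^ N k * μ (C k)`.
  set b : ℕ → ℝ≥0∞ → ℝ≥0∞ := fun k η => 8⁻¹ * (2⁻¹ ^ N k * μ (C k η)) with hb
  set η : ℕ → ℝ≥0∞ := fun k => Nat.rec 1
    (fun k e => b k e * ((M (k + 1) : ℝ≥0∞) * N (k + 1))⁻¹) k
  have hηs : ∀ k, η (k + 1) = b k (η k) * ((M (k + 1) : ℝ≥0∞) * N (k + 1))⁻¹ := fun k => rfl
  have hb0 : ∀ k e, 0 < e → 0 < b k e := fun k e he =>
    ENNReal.mul_pos (by simp) (ENNReal.mul_pos (by simp) (hC0 k e he).ne').ne'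
  have hη0 : ∀ k, 0 < η k := by
    intro k
    induction k with
    | zero => exact one_pos
    | succ k ih =>
      rw [hηs]
      exact ENNReal.mul_pos (hb0 k _ ih).ne'
        (ENNReal.inv_ne_zero.2 (ENNReal.mul_ne_top (by simp) (by simp)))
  have hMN : ∀ k, (1 : ℝ≥0∞) ≤ M k * N k := fun k =>
    one_le_mul (by exact_mod_cast hM k) (by exact_mod_cast hN k)
  have ha : ∀ k, M (k + 1) * (N (k + 1) * μ (C (k + 1) (η (k + 1)))) ≤ b k (η k) := fun k => by
    rw [← mul_assoc]
    calc (M (k + 1) * N (k + 1) : ℝ≥0∞) * μ (C (k + 1) (η (k + 1)))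
        ≤ (M (k + 1) * N (k + 1) : ℝ≥0∞) * η (k + 1) := by gcongr; exact hCη _ _ (hη0 (k + 1))
      _ = b k (η k) := by
        rw [hηs, mul_left_comm, ENNReal.mul_inv_cancel
          (zero_lt_one.trans_le (hMN _)).ne' (ENNReal.mul_ne_top (by simp) (by simp)), mul_one]
  have hbs : ∀ k, b (k + 1) (η (k + 1)) ≤ 2⁻¹ * b k (η k) := fun k => by
    calc b (k + 1) (η (k + 1)) ≤ 2⁻¹ * (1 * μ (C (k + 1) (η (k + 1)))) := by
          simp only [hb]
          gcongr
          · norm_num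
          · exact pow_le_one₀ (by simp) (by simp)
      _ ≤ 2⁻¹ * (M (k + 1) * N (k + 1) * μ (C (k + 1) (η (k + 1)))) := by
          gcongr
          exact hMN _
      _ ≤ 2⁻¹ * b k (η k) := by rw [mul_assoc]; gcongr; exact ha k
  have hbg : ∀ k i, b (k + i) (η (k + i)) ≤ 2⁻¹ ^ i * b k (η k) := fun k i => by
    induction i with
    | zero => simp
    | succ i ih =>
      calc b (k + (i + 1)) (η (k + (i + 1))) ≤ 2⁻¹ * b (k + i) (η (k + i)) := hbs (k + i)
        _ ≤ 2⁻¹ * (2⁻¹ ^ i * b k (η k)) := by gcongr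
        _ = _ := by rw [pow_succ]; ring
  refine ⟨fun k => C k (η k), fun k => hCm k _ (hη0 k), fun k => hC k _ (hη0 k), fun k => ?_⟩
  have hpos : 0 < 2⁻¹ ^ N k * μ (C k (η k)) := ENNReal.mul_pos (by simp) (hC0 k _ (hη0 k)).ne'
  have hfin : 2⁻¹ ^ N k * μ (C k (η k)) ≠ ∞ := ENNReal.mul_ne_top (by simp) (by simp)
  calc 2 * ∑' i, (M (k + 1 + i) * (N (k + 1 + i) * μ (C (k + 1 + i) (η (k + 1 + i)))) : ℝ≥0∞)
      ≤ 2 * ∑' i, 2⁻¹ ^ i * b k (η k) := by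
        refine mul_le_mul' le_rfl (ENNReal.tsum_le_tsum fun i => ?_)
        have := (ha (k + i)).trans (hbg k i)
        rwa [add_right_comm] at this
    _ = 2⁻¹ * (2⁻¹ ^ N k * μ (C k (η k))) := by
        rw [ENNReal.tsum_mul_right, ENNReal.tsum_geometric, ENNReal.one_sub_inv_two, inv_inv]
        simp only [hb]
        rw [← mul_assoc, ← mul_assoc]
        congr 1
        rw [show (8 : ℝ≥0∞) = 2 * 2 * 2 by norm_num, ENNReal.mul_inv (by simp) (by simp),
          ← mul_assoc, ENNReal.mul_inv_cancel (by simp) (by norm_num), one_mul]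
    _ < 2⁻¹ ^ N k * μ (C k (η k)) := by
        conv_rhs => rw [← one_mul (2⁻¹ ^ N k * μ (C k (η k)))]
        exact ENNReal.mul_lt_mul_left hpos.ne' hfin (by simp)

end Ergodic

/-! ### Measurable labellings by towers -/

section Towers

variable {X : Type*}

/-- The union of the first `N` preimages of `C` under `T`. -/
def tower (T : X → X) (C : Set X) (N : ℕ) : Set X := ⋃ j ∈ Finset.range N, T^[j] ⁻¹' C

theorem mem_tower {T : X → X} {C : Set X} {N : ℕ} {x : X} :
    x ∈ tower T C N ↔ ∃ j < N, T^[j] x ∈ C := by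
  simp [tower]

variable [MeasurableSpace X]

theorem measurable_comp_of_countable {ι β : Type*} [Countable ι] [MeasurableSpace β] {g : X → ι}
    (hg : ∀ i, MeasurableSet (g ⁻¹' {i})) (f : ι → β) : Measurable fun x => f (g x) := by
  let _ : MeasurableSpace ι := ⊤
  have : Measurable g := measurable_to_countable' hg
  exact (measurable_from_top (f := f)).comp this

/-- A countable disjoint family of measurable sets is encoded by a measurable label, with `none` for
the points outside the family. -/
theorem exists_measurable_label {ι : Type*} [Countable ι] {P : ι → Set X}
    (hm : ∀ p, MeasurableSet (P p)) (hd : ∀ p q x, x ∈ P p → x ∈ P q → p = q) :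
    ∃ lab : X → Option ι, (∀ o, MeasurableSet (lab ⁻¹' {o})) ∧
      ∀ x p, lab x = some p ↔ x ∈ P p := by
  classical
  set lab : X → Option ι := fun x => if h : ∃ p, x ∈ P p then some h.choose else none with hlab
  have key : ∀ x p, lab x = some p ↔ x ∈ P p := by
    intro x p
    by_cases h : ∃ p, x ∈ P p
    · have hx : lab x = some h.choose := dif_pos h
      rw [hx, Option.some_inj]
      exact ⟨fun e => e ▸ h.choose_spec, fun hp => hd _ _ x h.choose_spec hp⟩
    · have hx : lab x = none := dif_neg h
      rw [hx]
      exact ⟨fun e => by simp at e, fun hp => absurd ⟨p, hp⟩ h⟩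
  refine ⟨lab, fun o => ?_, key⟩
  cases o with
  | some p =>
    convert! hm p using 1
    ext x
    exact key x p
  | none =>
    convert! (MeasurableSet.iUnion hm).compl using 1
    ext x
    simp only [Set.mem_preimage, Set.mem_singleton_iff, Set.mem_compl_iff, Set.mem_iUnion,
      Option.eq_none_iff_forall_ne_some, ne_eq, key, not_exists]

theorem measurableSet_tower {T : X → X} (hT : Measurable T) {C : Set X} (hC : MeasurableSet C)
    (N : ℕ) : MeasurableSet (tower T C N) :=
  Finset.measurableSet_biUnion _ fun a _ => hT.iterate a hC

theorem measure_tower_le {μ : Measure X} {T : X → X} (hT : MeasurePreserving T μ μ) {C : Set X}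
    (hC : MeasurableSet C) (N : ℕ) : μ (tower T C N) ≤ N * μ C :=
  (measure_biUnion_finset_le _ _).trans_eq <| by
    simp [(hT.iterate _).measure_preimage hC.nullMeasurableSet]

/-- Given towers over bases `C k` of heights `N k`, each point can be labelled by the last tower
`k` it belongs to, together with its level `n` there: level `0` is the bottom of the tower, and
`T` moves one level up until level `N k - 1`, which is the base `C k`. Points in no tower or in
infinitely many of them have label `none`. -/
theorem exists_tower_label {T : X → X} (hT : Measurable T) {C : ℕ → Set X} {N : ℕ → ℕ}
    (hC : ∀ k, MeasurableSet (C k))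
    (hd : ∀ k i, 0 < i → i < N k → Disjoint (C k) (T^[i] ⁻¹' C k)) :
    ∃ lab : X → Option (ℕ × ℕ), (∀ o, MeasurableSet (lab ⁻¹' {o})) ∧
      ∀ x k n, lab x = some (k, n) ↔
        n < N k ∧ T^[N k - 1 - n] x ∈ C k ∧ ∀ l, k < l → x ∉ tower T (C l) (N l) := by
  refine (exists_measurable_label (X := X) (ι := ℕ × ℕ)
    (P := fun p => {x | p.2 < N p.1 ∧ T^[N p.1 - 1 - p.2] x ∈ C p.1 ∧
      ∀ l, p.1 < l → x ∉ tower T (C l) (N l)}) ?_ ?_).imp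
    fun lab h => ⟨h.1, fun x k n => h.2 x (k, n)⟩
  · rintro ⟨k, n⟩
    refine (MeasurableSet.const _).inter ((hT.iterate _ (hC k)).inter ?_)
    have : {x | ∀ l, k < l → x ∉ tower T (C l) (N l)} =
        ⋂ l, ⋂ (_ : k < l), (tower T (C l) (N l))ᶜ := by
      ext x; simp
    change MeasurableSet {x | ∀ l, k < l → x ∉ tower T (C l) (N l)}
    rw [this]
    exact MeasurableSet.iInter fun l => MeasurableSet.iInter fun _ =>
      (measurableSet_tower hT (hC l) _).compl
  · rintro ⟨k, n⟩ ⟨k', n'⟩ x ⟨hn, hx, hl⟩ ⟨hn', hx', hl'⟩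
    dsimp only at *
    have hkk : k = k' := by
      rcases lt_trichotomy k k' with h | h | h
      · exact absurd (mem_tower.2 ⟨_, by omega, hx'⟩) (hl k' h)
      · exact h
      · exact absurd (mem_tower.2 ⟨_, by omega, hx⟩) (hl' k h)
    subst hkk
    have aux : ∀ a b, a < b → b < N k → T^[a] x ∈ C k → T^[b] x ∈ C k → False := by
      intro a b hab hb ha hb'
      refine Set.disjoint_left.1 (hd k (b - a) (by omega) (by omega)) ha ?_
      rw [Set.mem_preimage, ← Function.iterate_add_apply, Nat.sub_add_cancel hab.le]
      exact hb'
    rcases lt_trichotomy n n' with h | h | h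
    · exact (aux _ _ (by omega) (by omega) hx' hx).elim
    · rw [h]
    · exact (aux _ _ (by omega) (by omega) hx hx').elim

end Towers

/-! ### Discounted sums along orbits -/

section Discounted

variable {X : Type*}

/-- The sum of `h` along the forward orbit of `x`, the `n`-th term with weight `2⁻ⁿ`. -/
noncomputable def discountedSum (T : X → X) (h : X → ℝ≥0∞) (x : X) : ℝ≥0∞ :=
  ∑' n, 2⁻¹ ^ n * h (T^[n] x)

theorem le_discountedSum {T : X → X} {h : X → ℝ≥0∞} (x : X) (n : ℕ) :
    2⁻¹ ^ n * h (T^[n] x) ≤ discountedSum T h x :=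
  ENNReal.le_tsum (f := fun n => 2⁻¹ ^ n * h (T^[n] x)) n

variable [MeasurableSpace X]

theorem measurable_discountedSum {T : X → X} (hT : Measurable T) {h : X → ℝ≥0∞}
    (hh : Measurable h) : Measurable (discountedSum T h) :=
  Measurable.tsum fun n => (hh.comp (hT.iterate n)).const_mul _

theorem tsum_inv_two_pow : ∑' n : ℕ, (2⁻¹ : ℝ≥0∞) ^ n = 2 := by
  rw [ENNReal.tsum_geometric, ENNReal.one_sub_inv_two, inv_inv]

theorem lintegral_discountedSum {μ : Measure X} {T : X → X} (hT : MeasurePreserving T μ μ)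
    {h : X → ℝ≥0∞} (hh : Measurable h) :
    ∫⁻ x, discountedSum T h x ∂μ = 2 * ∫⁻ x, h x ∂μ := by
  unfold discountedSum
  have hm : ∀ n : ℕ, AEMeasurable (fun x => 2⁻¹ ^ n * h (T^[n] x)) μ := fun n =>
    ((hh.comp (hT.measurable.iterate n)).const_mul (2⁻¹ ^ n)).aemeasurable
  rw [lintegral_tsum hm]
  have : ∀ n : ℕ, ∫⁻ x, 2⁻¹ ^ n * h (T^[n] x) ∂μ = 2⁻¹ ^ n * ∫⁻ x, h x ∂μ := fun n => by
    rw [lintegral_const_mul (f := fun x => h (T^[n] x)) _ (hh.comp (hT.measurable.iterate n)),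
      (hT.iterate n).lintegral_comp hh]
  simp_rw [this]
  rw [ENNReal.tsum_mul_right, tsum_inv_two_pow]

end Discounted

/-! ### Isomorphisms given by injective factor maps -/

/-- A factor map which is injective on a set of full measure is an isomorphism onto the image
system, by the Lusin-Souslin theorem. -/
theorem isomorphicSystems_map {X Y : Type*} [MeasurableSpace X] [StandardBorelSpace X]
    [MeasurableSpace Y] [StandardBorelSpace Y] {μ : Measure X} [IsProbabilityMeasure μ]
    {T : X → X} (hT : MeasurePreserving T μ μ) {A : Y → Y} (hA : Measurable A) {Φ : X → Y}
    (hΦ : Measurable Φ) {S : Set X} (hS : MeasurableSet S) (hμS : ∀ᵐ x ∂μ, x ∈ S)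
    (hinj : Set.InjOn Φ S) (heq : ∀ᵐ x ∂μ, Φ (T x) = A (Φ x)) :
    MeasurePreserving A (μ.map Φ) (μ.map Φ) ∧ IsomorphicSystems μ T (μ.map Φ) A := by
  have hΦm : MeasurePreserving Φ μ (μ.map Φ) := hΦ.measurePreserving μ
  constructor
  · refine ⟨hA, ?_⟩
    calc (μ.map Φ).map A = μ.map (A ∘ Φ) := Measure.map_map hA hΦ
      _ = μ.map (Φ ∘ T) := (Measure.map_congr heq).symm
      _ = (μ.map T).map Φ := (Measure.map_map hΦ hT.measurable).symm
      _ = μ.map Φ := by rw [hT.map_eq]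
  have := hS.standardBorel
  have hemb : MeasurableEmbedding fun x : S => Φ x :=
    (hΦ.comp measurable_subtype_coe).measurableEmbedding (Set.injOn_iff_injective.1 hinj)
  have : Nonempty X := nonempty_of_isProbabilityMeasure μ
  obtain ⟨Ψ, hΨ, hΨΦ⟩ := hemb.exists_measurable_extend (g := fun x : S => (x : X))
    measurable_subtype_coe fun _ => this
  have hΨΦ : ∀ x ∈ S, Ψ (Φ x) = x := fun x hx => congrFun hΨΦ ⟨x, hx⟩
  have hae : ∀ᵐ x ∂μ, Ψ (Φ x) = x := hμS.mono hΨΦ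
  refine ⟨Φ, Ψ, hΦm, ⟨hΨ, ?_⟩, hae, ?_, heq⟩
  · rw [Measure.map_map hΨ hΦ, Measure.map_congr (f := Ψ ∘ Φ) (g := id) hae, Measure.map_id]
  · refine (ae_map_iff hΦ.aemeasurable (measurableSet_eq_fun (hΦ.comp hΨ) measurable_id)).2 ?_
    exact hae.mono fun x hx => congrArg Φ hx

/-! ### Backward orbits and the coding of ergodic systems -/

section Coding

variable {𝕜 Z : Type*} [RCLike 𝕜] [NormedAddCommGroup Z] [NormedSpace 𝕜 Z]

/-- The space of backward orbits of `A`: sequences `ζ` with `A (ζ 0) = 0` and `A (ζ (n + 1)) = ζ n`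
which decay like `2⁻ⁿ`. With respect to the functionals `θ i`, they are moreover required to be
visible at time `0` only, and to be seen there by finitely many `θ i` only. -/
def backwardOrbits (A : Z →L[𝕜] Z) (θ : ℕ → Z →L[𝕜] 𝕜) : Submodule 𝕜 (ℕ → Z) where
  carrier := {ζ | (A (ζ 0) = 0 ∧ ∀ n, A (ζ (n + 1)) = ζ n) ∧
    (∃ M : ℝ≥0, ∀ n, ‖ζ n‖ₑ ≤ M * 2⁻¹ ^ n) ∧
    (∀ i n, θ i (ζ (n + 1)) = 0) ∧ ∀ᶠ i in atTop, θ i (ζ 0) = 0}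
  zero_mem' := ⟨⟨by simp, by simp⟩, ⟨0, by simp⟩, by simp, by simp⟩
  add_mem' := by
    rintro ζ ξ ⟨⟨h1, h2⟩, ⟨M, hM⟩, h3, h4⟩ ⟨⟨k1, k2⟩, ⟨K, hK⟩, k3, k4⟩
    refine ⟨⟨by simp [h1, k1], fun n => by simp [h2, k2]⟩, ⟨M + K, fun n => ?_⟩,
      fun i n => by simp [h3, k3], ?_⟩
    · rw [ENNReal.coe_add, add_mul]
      exact (enorm_add_le _ _).trans (add_le_add (hM n) (hK n))
    · filter_upwards [h4, k4] with i hi ki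
      simp [hi, ki]
  smul_mem' := by
    rintro c ζ ⟨⟨h1, h2⟩, ⟨M, hM⟩, h3, h4⟩
    refine ⟨⟨by simp [h1], fun n => by simp [h2]⟩, ⟨‖c‖₊ * M, fun n => ?_⟩,
      fun i n => by simp [h3], ?_⟩
    · rw [ENNReal.coe_mul, mul_assoc, Pi.smul_apply, enorm_smul]
      exact mul_le_mul' le_rfl (hM n)
    · filter_upwards [h4] with i hi
      simp [hi]

/-- A measurable injection into `(1, 2)`. -/
theorem exists_measurable_injective_Ioo (X : Type*) [MeasurableSpace X] [StandardBorelSpace X] :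
    ∃ ι : X → ℝ, Measurable ι ∧ Function.Injective ι ∧ ∀ x, 1 < ι x ∧ ι x < 2 := by
  obtain ⟨f, hf⟩ := exists_measurableEmbedding_real X
  have hπ := Real.pi_pos
  refine ⟨fun x => 3 / 2 + Real.arctan (f x) / Real.pi, ?_, fun x y hxy => ?_, fun x => ?_⟩
  · exact ((Real.continuous_arctan.measurable.comp hf.measurable).div_const _).const_add _
  · have h : Real.arctan (f x) / Real.pi = Real.arctan (f y) / Real.pi := add_left_cancel hxy
    exact hf.injective (Real.arctan_injective ((div_left_inj' hπ.ne').1 h))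
  · have h1 := Real.neg_pi_div_two_lt_arctan (f x)
    have h2 := Real.arctan_lt_pi_div_two (f x)
    have h3 : -(1 / 2) < Real.arctan (f x) / Real.pi := by rw [lt_div_iff₀ hπ]; linarith
    have h4 : Real.arctan (f x) / Real.pi < 1 / 2 := by rw [div_lt_iff₀ hπ]; linarith
    constructor <;> linarith

/-- The intervals `(2⁻ᵃ, 2 * 2⁻ᵃ)` are disjoint, so a point of `(1, 2)` can be recovered from any
of its dyadic multiples. -/
theorem two_inv_pow_mul_inj {a b : ℕ} {s t : ℝ} (hs : 1 < s ∧ s < 2) (ht : 1 < t ∧ t < 2)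
    (h : (2⁻¹ : ℝ) ^ a * s = 2⁻¹ ^ b * t) : s = t := by
  have key : ∀ (a b : ℕ) (s t : ℝ), s < 2 → 1 < t → a < b → (2⁻¹ : ℝ) ^ a * t ≠ 2⁻¹ ^ b * s := by
    intro a b s t hs ht hab
    have h1 : (2⁻¹ : ℝ) ^ b ≤ 2⁻¹ ^ (a + 1) :=
      pow_le_pow_of_le_one (by norm_num) (by norm_num) hab
    have h2 : (0 : ℝ) < 2⁻¹ ^ a := by positivity
    have h3 : (0 : ℝ) < 2⁻¹ ^ b := by positivity
    rw [pow_succ] at h1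
    nlinarith
  rcases lt_trichotomy a b with hab | rfl | hab
  · exact absurd h (key a b t s ht.2 hs.1 hab)
  · exact mul_left_cancel₀ (by positivity) h
  · exact absurd h.symm (key b a s t hs.2 ht.1 hab)

theorem tsum_ite_two_inv_pow (N : ℕ) (c : ℝ≥0∞) :
    ∑' n : ℕ, (if n < N then 0 else 2⁻¹ ^ n * c) = 2 * 2⁻¹ ^ N * c := by
  rw [← Summable.sum_add_tsum_nat_add' (k := N) ENNReal.summable,
    Finset.sum_eq_zero fun i hi => if_pos (Finset.mem_range.1 hi), zero_add]
  have : ∀ n : ℕ, (if n + N < N then 0 else (2⁻¹ : ℝ≥0∞) ^ (n + N) * c) =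
      2⁻¹ ^ n * (2⁻¹ ^ N * c) := fun n => by
    rw [if_neg (by omega), pow_add, mul_assoc]
  simp_rw [this]
  rw [ENNReal.tsum_mul_right, tsum_inv_two_pow, mul_assoc]

variable [CompleteSpace Z] [MeasurableSpace Z] [BorelSpace Z] [SecondCountableTopology Z]

/-- The coding of an ergodic system. The backward orbits `F k n` for `n < N k` are those of the
`k`-th target vector `∑ n < N k, F k n n`, and the constants `M k` bound their decay. -/
theorem exists_factor_map {A : Z →L[𝕜] Z} {θ : ℕ → Z →L[𝕜] 𝕜} {w : ℕ → Z} {Mw : ℝ≥0}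
    (hw0 : A (w 0) = 0) (hw : ∀ n, A (w (n + 1)) = w n) (hMw : ∀ n, ‖w n‖ₑ ≤ Mw * 2⁻¹ ^ n)
    (hθw : ∀ i n, θ i (w (n + 1)) = 0) (hθw0 : ∀ i, θ i (w 0) ≠ 0)
    {F : ℕ → ℕ → ℕ → Z} {M : ℕ → ℝ≥0} {N : ℕ → ℕ}
    (hF : ∀ k n, F k n ∈ backwardOrbits A θ) (hFM : ∀ k n m, ‖F k n m‖ₑ ≤ M k * 2⁻¹ ^ m)
    (hFN : ∀ k n, N k ≤ n → F k n = 0) (hMmono : Monotone M) (hM1 : ∀ k, 1 ≤ M k)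
    (hN1 : ∀ k, 1 ≤ N k) (hkN : ∀ k, k ≤ N k)
    (hNM : ∀ k, 2 * 2⁻¹ ^ N k * (M k + 2 * Mw : ℝ≥0∞) ≤ 2⁻¹ ^ k)
    (hdense : ∀ U : Set Z, IsOpen U → U.Nonempty → ∃ v ∈ U, ∀ K, ∃ k ≥ K,
      ∑ n ∈ Finset.range (N k), F k n n = v)
    {X : Type*} [MeasurableSpace X] [StandardBorelSpace X] {μ : Measure X}
    [IsProbabilityMeasure μ] [NullSingletonClass μ] {T : X → X} (hT : Ergodic T μ) :
    ∃ (Φ : X → Z) (S : Set X), Measurable Φ ∧ MeasurableSet S ∧ (∀ᵐ x ∂μ, x ∈ S) ∧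
      Set.InjOn Φ S ∧ (∀ x ∈ S, Φ (T x) = A (Φ x)) ∧
      ∀ U : Set Z, IsOpen U → U.Nonempty → 0 < μ (Φ ⁻¹' U) := by
  have hTm := hT.measurable
  have hTp := hT.toMeasurePreserving
  obtain ⟨C, hCm, hCd, hC⟩ := exists_tower_bases hT M N hM1 hN1
  obtain ⟨lab, hlabm, hlab⟩ := exists_tower_label hTm hCm hCd
  obtain ⟨ι, hιm, hιi, hι⟩ := exists_measurable_injective_Ioo X
  -- The backward orbit attached to a label, and the exponent of the size of the perturbation.
  set c : Option (ℕ × ℕ) → ℕ → Z := fun o => o.elim 0 fun p => F p.1 p.2 with hc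
  set a : Option (ℕ × ℕ) → ℕ := fun o => o.elim 0 fun p => p.1 + 1 with ha
  set Mo : Option (ℕ × ℕ) → ℝ≥0∞ := fun o => o.elim 0 fun p => (M p.1 : ℝ≥0∞) with hMo
  have hcD : ∀ o, c o ∈ backwardOrbits A θ := by
    rintro (_ | p)
    · exact Submodule.zero_mem _
    · exact hF _ _
  have hcM : ∀ o m, ‖c o m‖ₑ ≤ Mo o * 2⁻¹ ^ m := by
    rintro (_ | p) m
    · simp [hc]
    · exact hFM _ _ _
  set s : X → ℝ := fun x => 2⁻¹ ^ a (lab x) * ι x with hs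
  have hsm : Measurable s := (measurable_comp_of_countable hlabm fun o => (2⁻¹ : ℝ) ^ a o).mul hιm
  have hs2 : ∀ x, ‖(s x : 𝕜)‖ₑ ≤ 2⁻¹ ^ a (lab x) * 2 := fun x => by
    have h1 : ‖(s x : 𝕜)‖ₑ = ENNReal.ofReal (s x) := by
      rw [← ofReal_norm, RCLike.norm_ofReal, abs_of_nonneg]
      have := (hι x).1
      positivity
    rw [h1, hs, ENNReal.ofReal_mul (by positivity), ENNReal.ofReal_pow (by norm_num),
      ENNReal.ofReal_inv_of_pos (by norm_num), ENNReal.ofReal_ofNat]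
    gcongr
    exact (ENNReal.ofReal_le_ofReal (hι x).2.le).trans (by simp)
  set ξ : X → ℕ → Z := fun x m => c (lab x) m + (s x : 𝕜) • w m with hξ
  have hξm : ∀ m, Measurable fun x => ξ x m := fun m =>
    (measurable_comp_of_countable hlabm fun o => c o m).add
      ((RCLike.measurable_ofReal.comp hsm).smul_const _)
  have hξ0 : ∀ x, A (ξ x 0) = 0 := fun x => by
    simp only [hξ, map_add, map_smul, (hcD _).1.1, hw0, smul_zero, add_zero]
  have hξs : ∀ x m, A (ξ x (m + 1)) = ξ x m := fun x m => by
    simp only [hξ, map_add, map_smul, (hcD _).1.2, hw]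
  have hwb : ∀ x m, ‖(s x : 𝕜) • w m‖ₑ ≤ 2⁻¹ ^ m * (2⁻¹ ^ a (lab x) * (2 * Mw)) := fun x m => by
    rw [enorm_smul]
    calc ‖(s x : 𝕜)‖ₑ * ‖w m‖ₑ ≤ (2⁻¹ ^ a (lab x) * 2) * (Mw * 2⁻¹ ^ m) :=
          mul_le_mul' (hs2 x) (hMw m)
      _ = _ := by ring
  set h : X → ℝ≥0∞ := fun x => Mo (lab x) + 2 * Mw with hh
  have hhm : Measurable h := (measurable_comp_of_countable hlabm Mo).add_const _
  have hξb : ∀ x m, ‖ξ x m‖ₑ ≤ 2⁻¹ ^ m * h x := fun x m => by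
    refine (enorm_add_le _ _).trans ?_
    rw [hh, mul_add]
    refine add_le_add ((hcM _ _).trans_eq (mul_comm _ _)) ((hwb x m).trans ?_)
    refine mul_le_mul' le_rfl (mul_le_of_le_one_left' (pow_le_one₀ (by simp) (by simp)))
  -- The contribution of the towers after the `k`-th one.
  set g : ℕ → X → ℝ≥0∞ := fun k x =>
    ∑' l, M (k + 1 + l) * (tower T (C (k + 1 + l)) (N (k + 1 + l))).indicator 1 x with hg
  have hgtm : ∀ k l, Measurable fun x => (M (k + 1 + l) : ℝ≥0∞) *
      (tower T (C (k + 1 + l)) (N (k + 1 + l))).indicator 1 x := fun k l =>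
    (measurable_one.indicator (measurableSet_tower hTm (hCm _) _)).const_mul _
  have hgm : ∀ k, Measurable (g k) := fun k => Measurable.tsum fun l => hgtm k l
  have hgle : ∀ k l x, k < l → x ∈ tower T (C l) (N l) → (M l : ℝ≥0∞) ≤ g k x := by
    intro k l x hkl hx
    obtain ⟨j, rfl⟩ := Nat.exists_eq_add_of_lt hkl
    rw [add_right_comm k j 1] at hx ⊢
    refine le_trans ?_ (ENNReal.le_tsum j)
    rw [Set.indicator_of_mem hx]
    simp
  have hgint : ∀ k, 2 * ∫⁻ x, g k x ∂μ < 2⁻¹ ^ N k * μ (C k) := fun k => by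
    refine lt_of_le_of_lt ?_ (hC k)
    rw [hg, lintegral_tsum fun l => (hgtm k l).aemeasurable]
    refine mul_le_mul' le_rfl (ENNReal.tsum_le_tsum fun l => ?_)
    rw [lintegral_const_mul _ (measurable_one.indicator (measurableSet_tower hTm (hCm _) _)),
      lintegral_indicator_one (measurableSet_tower hTm (hCm _) _)]
    exact mul_le_mul' le_rfl (measure_tower_le hTp (hCm _) _)
  have hhg : ∀ k x, h x ≤ (M k + 2 * Mw) + g k x := fun k x => by
    rw [hh, add_right_comm]
    refine add_le_add ?_ le_rfl
    rcases hx : lab x with _ | ⟨l, n⟩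
    · simp [hMo]
    rcases le_or_gt l k with hl | hl
    · exact le_add_right (ENNReal.coe_le_coe.2 (hMmono hl))
    · obtain ⟨hn, hxn, -⟩ := (hlab x l n).1 hx
      exact le_add_left (hgle k l x hl (mem_tower.2 ⟨_, by omega, hxn⟩))
  -- The factor map; its series converges where the discounted sum of `h` is finite.
  set Φ : X → Z := fun x => ∑' n, ξ (T^[n] x) n with hΦ
  have hΦm : Measurable Φ := Measurable.tsum fun n => (hξm n).comp (hTm.iterate n)
  have hsum : ∀ x, discountedSum T h x < ∞ → Summable fun n => ξ (T^[n] x) n := fun x hx =>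
    Summable.of_enorm ((ENNReal.tsum_le_tsum fun n => hξb _ n).trans_lt hx).ne
  have hΦT : ∀ x, discountedSum T h x < ∞ → Φ (T x) = A (Φ x) := fun x hx => by
    simp only [hΦ]
    rw [A.map_tsum (hsum x hx), ((hsum x hx).mapL A).tsum_eq_zero_add]
    simp only [Function.iterate_zero, id_eq, hξ0, zero_add, hξs, Function.iterate_succ_apply]
  have hθΦ : ∀ x i, discountedSum T h x < ∞ →
      θ i (Φ x) = θ i (c (lab x) 0) + s x * θ i (w 0) := fun x i hx => by
    simp only [hΦ]
    rw [(θ i).map_tsum (hsum x hx), tsum_eq_single 0]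
    · simp [hξ]
    · intro n hn
      obtain ⟨m, rfl⟩ := Nat.exists_eq_succ_of_ne_zero hn
      simp only [Nat.succ_eq_add_one, hξ, map_add, map_smul, hθw, (hcD _).2.2.1, smul_zero,
        add_zero]
  refine ⟨Φ, {x | discountedSum T h x < ∞}, hΦm,
    measurableSet_lt (measurable_discountedSum hTm hhm) measurable_const, ?_, ?_, hΦT, ?_⟩
  · refine ae_lt_top (measurable_discountedSum hTm hhm) ?_
    rw [lintegral_discountedSum hTp hhm]
    refine ENNReal.mul_ne_top (by simp) (ne_of_lt ?_)
    calc ∫⁻ x, h x ∂μ ≤ ∫⁻ x, (M 0 + 2 * Mw) + g 0 x ∂μ := lintegral_mono (hhg 0)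
      _ = (M 0 + 2 * Mw) + ∫⁻ x, g 0 x ∂μ := by
        rw [lintegral_add_left measurable_const]; simp
      _ < ∞ := by
        refine ENNReal.add_lt_top.2 ⟨by finiteness, ?_⟩
        refine lt_of_le_of_lt (le_mul_of_one_le_left' one_le_two) ((hgint 0).trans ?_)
        exact ENNReal.mul_lt_top (by finiteness) (measure_lt_top _ _)
  · -- Injectivity: almost all of the functionals `θ i` read off the perturbation `s`.
    intro x hx y hy hxy
    obtain ⟨i, hix, hiy⟩ := ((hcD (lab x)).2.2.2.and (hcD (lab y)).2.2.2).exists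
    have h1 := hθΦ x i hx
    rw [hxy, hθΦ y i hy, hix, hiy, zero_add, zero_add] at h1
    have h2 : s y = s x := RCLike.ofReal_injective (mul_right_cancel₀ (hθw0 i) h1)
    exact (hιi (two_inv_pow_mul_inj (hι y) (hι x) h2)).symm
  · -- Full support: on a large part of the top preimage of `C k`, the point `Φ x` is near the
    -- `k`-th target vector.
    have hclose : ∀ k x, T^[N k - 1] x ∈ C k → discountedSum T (g k) x < 2⁻¹ ^ N k →
        edist (Φ x) (∑ n ∈ Finset.range (N k), F k n n) ≤ 2⁻¹ ^ k * (2 * Mw + 2) := by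
      intro k x hxC hxg
      -- Since `1 ≤ M l`, a visit to a later tower before time `N k` would make the discounted sum
      -- of `g k` at least `2⁻¹ ^ N k`.
      have hlate : ∀ n < N k, ∀ l, k < l → T^[n] x ∉ tower T (C l) (N l) := by
        intro n hn l hl hx
        refine hxg.not_ge ?_
        calc (2⁻¹ : ℝ≥0∞) ^ N k ≤ 2⁻¹ ^ n * 1 := by
              rw [mul_one]
              exact pow_le_pow_right_of_le_one' (by simp) hn.le
          _ ≤ 2⁻¹ ^ n * g k (T^[n] x) :=
              mul_le_mul' le_rfl (le_trans (by exact_mod_cast hM1 l) (hgle k l _ hl hx))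
          _ ≤ _ := le_discountedSum x n
      have hlabx : ∀ n < N k, lab (T^[n] x) = some (k, n) := fun n hn => by
        refine (hlab _ k n).2 ⟨hn, ?_, hlate n hn⟩
        rw [← Function.iterate_add_apply, Nat.sub_add_cancel (by omega)]
        exact hxC
      have hF0 : ∀ n ∉ Finset.range (N k), F k n n = 0 := fun n hn => by
        rw [hFN k n (by simpa using hn)]; rfl
      have hfin : discountedSum T h x < ∞ := by
        calc discountedSum T h x
            ≤ ∑' n, (2⁻¹ ^ n * (M k + 2 * Mw) + 2⁻¹ ^ n * g k (T^[n] x)) :=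
              ENNReal.tsum_le_tsum fun n => by rw [← mul_add]; exact mul_le_mul' le_rfl (hhg k _)
          _ = 2 * (M k + 2 * Mw) + discountedSum T (g k) x := by
              rw [ENNReal.tsum_add, ENNReal.tsum_mul_right, tsum_inv_two_pow, discountedSum]
          _ < ∞ := ENNReal.add_lt_top.2 ⟨by finiteness, hxg.trans_le le_top⟩
      have hterm : ∀ n, ‖ξ (T^[n] x) n - F k n n‖ₑ ≤ 2⁻¹ ^ n * (2⁻¹ ^ k * Mw) +
          2⁻¹ ^ n * g k (T^[n] x) + (if n < N k then 0 else 2⁻¹ ^ n * (M k + 2 * Mw) : ℝ≥0∞) := by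
        intro n
        split_ifs with hn
        · have h1 : ξ (T^[n] x) n - F k n n = (s (T^[n] x) : 𝕜) • w n := by
            simp only [hξ, hc, hlabx n hn, Option.elim_some, add_sub_cancel_left]
          rw [h1, add_zero]
          refine le_add_right ((hwb _ n).trans_eq ?_)
          simp only [ha, hlabx n hn, Option.elim_some]
          rw [pow_succ, mul_assoc _ 2⁻¹, ← mul_assoc 2⁻¹,
            ENNReal.inv_mul_cancel (by simp) (by simp), one_mul]
        · rw [hF0 n (by simpa using hn), sub_zero]
          refine (hξb _ n).trans ?_
          calc 2⁻¹ ^ n * h (T^[n] x) ≤ 2⁻¹ ^ n * ((M k + 2 * Mw) + g k (T^[n] x)) :=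
                mul_le_mul' le_rfl (hhg k _)
            _ = 2⁻¹ ^ n * g k (T^[n] x) + 2⁻¹ ^ n * (M k + 2 * Mw) := by ring
            _ ≤ _ := by gcongr; exact le_add_self
      have hFs : HasSum (fun n => F k n n) (∑ n ∈ Finset.range (N k), F k n n) :=
        hasSum_sum_of_ne_finset_zero hF0
      rw [edist_eq_enorm_sub, ← hFs.tsum_eq, hΦ, ← (hsum x hfin).tsum_sub hFs.summable]
      calc ‖∑' n, (ξ (T^[n] x) n - F k n n)‖ₑ ≤ ∑' n, ‖ξ (T^[n] x) n - F k n n‖ₑ :=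
            enorm_tsum_le_tsum_enorm
        _ ≤ _ := ENNReal.tsum_le_tsum hterm
        _ = 2 * (2⁻¹ ^ k * Mw) + discountedSum T (g k) x + 2 * 2⁻¹ ^ N k * (M k + 2 * Mw) := by
            rw [ENNReal.tsum_add, ENNReal.tsum_add, ENNReal.tsum_mul_right, tsum_inv_two_pow,
              tsum_ite_two_inv_pow, discountedSum]
        _ ≤ 2 * (2⁻¹ ^ k * Mw) + 2⁻¹ ^ k + 2⁻¹ ^ k := by
            refine add_le_add (add_le_add le_rfl (hxg.le.trans ?_)) (hNM k)
            exact pow_le_pow_right_of_le_one' (by simp) (hkN k)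
        _ = _ := by ring
    have hpos : ∀ k, 0 < μ ((T^[N k - 1] ⁻¹' C k) \ {x | 2⁻¹ ^ N k ≤ discountedSum T (g k) x}) := by
      intro k
      refine lt_of_lt_of_le (tsub_pos_of_lt ?_) le_measure_sdiff
      rw [(hTp.iterate _).measure_preimage (hCm k).nullMeasurableSet]
      refine (meas_ge_le_lintegral_div (measurable_discountedSum hTm (hgm k)).aemeasurable
        (by simp) (by simp)).trans_lt ?_
      rw [lintegral_discountedSum hTp (hgm k)]
      refine ENNReal.div_lt_of_lt_mul' (hgint k)
    intro U hU hUne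
    obtain ⟨v, hvU, hv⟩ := hdense U hU hUne
    obtain ⟨ε, hε, hball⟩ := EMetric.isOpen_iff.1 hU v hvU
    have hlim : Tendsto (fun k : ℕ => (2⁻¹ : ℝ≥0∞) ^ k * (2 * Mw + 2)) atTop (𝓝 0) := by
      have := ENNReal.Tendsto.mul_const (b := (2 * Mw + 2 : ℝ≥0∞))
        (ENNReal.tendsto_pow_atTop_nhds_zero_of_lt_one (r := 2⁻¹) (by simp))
        (Or.inr (by finiteness))
      rwa [zero_mul] at this
    obtain ⟨K, hK⟩ := eventually_atTop.1 (hlim.eventually (gt_mem_nhds hε))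
    obtain ⟨k, hkK, rfl⟩ := hv K
    refine (hpos k).trans_le (measure_mono fun x hx => hball ?_)
    exact (hclose k x hx.1 (not_le.1 hx.2)).trans_lt (hK k hkK)

end Coding

/-- An operator with a dense span of backward orbits, and with one more backward orbit `w` that
all the functionals `θ i` see, is universal. -/
theorem isUniversalForErgodicSystems_of_dense_span {𝕜 : Type u} {Z : Type w} [RCLike 𝕜]
    [NormedAddCommGroup Z] [NormedSpace 𝕜 Z] [CompleteSpace Z] [MeasurableSpace Z] [BorelSpace Z]
    [SecondCountableTopology Z] {A : Z →L[𝕜] Z} {θ : ℕ → Z →L[𝕜] 𝕜} {w : ℕ → Z} {Mw : ℝ≥0}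
    (hw0 : A (w 0) = 0) (hw : ∀ n, A (w (n + 1)) = w n) (hMw : ∀ n, ‖w n‖ₑ ≤ Mw * 2⁻¹ ^ n)
    (hθw : ∀ i n, θ i (w (n + 1)) = 0) (hθw0 : ∀ i, θ i (w 0) ≠ 0)
    (hspan : Dense (Submodule.span 𝕜 {z | ∃ ζ ∈ backwardOrbits A θ, ∃ n, ζ n = z} : Set Z)) :
    IsUniversalForErgodicSystems.{v} A := by
  classical
  -- Every vector of the span is of the form `∑ n, ζ n n` for finitely many backward orbits `ζ n`.
  set L : (ℕ →₀ backwardOrbits A θ) →ₗ[𝕜] Z :=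
    Finsupp.lsum 𝕜 fun n => (LinearMap.proj n).comp (backwardOrbits A θ).subtype with hL
  have hLa : ∀ f, L f = f.sum fun n ζ => (ζ : ℕ → Z) n := fun f => rfl
  have hLd : Dense (Set.range L) := by
    refine hspan.mono ?_
    change _ ≤ ((LinearMap.range L : Submodule 𝕜 Z) : Set Z)
    rw [SetLike.coe_subset_coe, Submodule.span_le]
    rintro _ ⟨ζ, hζ, n, rfl⟩
    exact ⟨Finsupp.single n ⟨ζ, hζ⟩, by rw [hLa, Finsupp.sum_single_index rfl]⟩
  obtain ⟨D, hDL, hDc, hDd⟩ := hLd.exists_countable_dense_subset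
  obtain ⟨d, rfl⟩ := hDc.exists_eq_range hDd.nonempty
  choose f hf using fun i => hDL ⟨i, rfl⟩
  choose! Mζ hMζ using fun (ζ : ℕ → Z) (hζ : ζ ∈ backwardOrbits A θ) => hζ.2.1
  set m : ℕ → ℝ≥0 := fun i => ∑ n ∈ (f i).support, Mζ (f i n) with hm
  have hfm : ∀ i n j, ‖(f i n : ℕ → Z) j‖ₑ ≤ m i * 2⁻¹ ^ j := fun i n j => by
    by_cases hn : n ∈ (f i).support
    · refine (hMζ _ (f i n).2 j).trans (mul_le_mul' (ENNReal.coe_le_coe.2 ?_) le_rfl)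
      exact Finset.single_le_sum (f := fun n => Mζ (f i n)) (fun _ _ => zero_le) hn
    · rw [Finsupp.notMem_support_iff.1 hn]
      simp
  -- Pairing functions enumerate the targets so that each one occurs infinitely often.
  set F : ℕ → ℕ → ℕ → Z := fun k n => f k.unpair.1 n with hF
  set M : ℕ → ℝ≥0 := fun k => 1 + ∑ l ∈ Finset.range (k + 1), m l.unpair.1 with hM
  have hN : ∀ k, ∃ N : ℕ, (1 ≤ N ∧ k ≤ N) ∧ (∀ n ∈ (f k.unpair.1).support, n < N) ∧
      2 * 2⁻¹ ^ N * (M k + 2 * Mw : ℝ≥0∞) ≤ 2⁻¹ ^ k := by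
    intro k
    have hlim : Tendsto (fun N : ℕ => 2 * (2⁻¹ : ℝ≥0∞) ^ N * (M k + 2 * Mw)) atTop (𝓝 0) := by
      have := ENNReal.Tendsto.mul_const (b := (M k + 2 * Mw : ℝ≥0∞))
        (ENNReal.Tendsto.const_mul (a := 2)
        (ENNReal.tendsto_pow_atTop_nhds_zero_of_lt_one (r := 2⁻¹) (by simp)) (Or.inr (by simp)))
        (Or.inr (by finiteness))
      simpa using this
    have hk : (0 : ℝ≥0∞) < 2⁻¹ ^ k := ENNReal.pow_pos (by simp) k
    refine Eventually.exists (f := atTop) (((eventually_ge_atTop 1).and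
      (eventually_ge_atTop k)).and (Eventually.and ?_ ?_))
    · filter_upwards [eventually_gt_atTop ((f k.unpair.1).support.sup id)] with N hN n hn
      exact (Finset.le_sup (f := id) hn).trans_lt hN
    · exact (hlim.eventually (gt_mem_nhds hk)).mono fun _ h => h.le
  choose N hN1 hNs hNM using hN
  have hFN : ∀ k n, N k ≤ n → F k n = 0 := fun k n hn => by
    have : n ∉ (f k.unpair.1).support := fun h => (hNs k n h).not_ge hn
    simp only [hF, Finsupp.notMem_support_iff.1 this, ZeroMemClass.coe_zero]
  have hFM : ∀ k n j, ‖F k n j‖ₑ ≤ M k * 2⁻¹ ^ j := fun k n j => by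
    refine (hfm _ n j).trans (mul_le_mul' (ENNReal.coe_le_coe.2 ?_) le_rfl)
    refine le_add_left (Finset.single_le_sum (f := fun l => m (Nat.unpair l).1)
      (fun _ _ => zero_le) (Finset.self_mem_range_succ k))
  have hMm : Monotone M := fun k l hkl => by
    refine add_le_add le_rfl (Finset.sum_le_sum_of_subset ?_)
    exact Finset.range_subset_range.2 (by omega)
  have hFsum : ∀ k, ∑ n ∈ Finset.range (N k), F k n n = d k.unpair.1 := fun k => by
    rw [← hf, hLa, Finsupp.sum_of_support_subset _ (s := Finset.range (N k))
      (fun n hn => Finset.mem_range.2 (hNs k n hn)) _ fun _ _ => rfl]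
  have hdense : ∀ U : Set Z, IsOpen U → U.Nonempty → ∃ v ∈ U, ∀ K, ∃ k ≥ K,
      ∑ n ∈ Finset.range (N k), F k n n = v := fun U hU hUne => by
    obtain ⟨_, hvU, i, rfl⟩ := hDd.inter_open_nonempty U hU hUne
    refine ⟨d i, hvU, fun K => ⟨Nat.pair i K, Nat.right_le_pair i K, ?_⟩⟩
    rw [hFsum, Nat.unpair_pair]
  intro X _ _ μ _ _ T hT
  obtain ⟨Φ, S, hΦ, hS, hμS, hinj, hΦT, hpos⟩ := exists_factor_map hw0 hw hMw hθw hθw0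
    (fun k n => (f k.unpair.1 n).2) hFM hFN hMm (fun k => le_self_add) (fun k => (hN1 k).1)
    (fun k => (hN1 k).2) hNM hdense hT
  obtain ⟨h1, h2⟩ := isomorphicSystems_map hT.toMeasurePreserving A.continuous.measurable hΦ hS
    hμS hinj (hμS.mono hΦT)
  refine ⟨μ.map Φ, Measure.isProbabilityMeasure_map hΦ.aemeasurable, ⟨fun U hU hUne => ?_⟩, h1, h2⟩
  rw [Measure.map_apply hΦ hU.measurableSet]
  exact (hpos U hU hUne).ne'

/-! ### Shift operators of a sub-symmetric basis -/

section Shifts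

variable {𝕜 E : Type*} [RCLike 𝕜] [NormedAddCommGroup E] [NormedSpace 𝕜 E]

/-- By the Banach-Steinhaus theorem, a series of rank one operators that converges at every point
defines a bounded operator. -/
theorem exists_clm_of_tendsto_series [CompleteSpace E] (g : ℕ → StrongDual 𝕜 E) (y : ℕ → E)
    (h : ∀ x, ∃ s, Tendsto (fun N => ∑ n ∈ Finset.range N, g n x • y n) atTop (𝓝 s)) :
    ∃ S : E →L[𝕜] E, ∀ x,
      Tendsto (fun N => ∑ n ∈ Finset.range N, g n x • y n) atTop (𝓝 (S x)) := by
  choose f hf using h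
  have hlim : Tendsto (fun N x => (∑ n ∈ Finset.range N, (g n).smulRight (y n)) x) atTop (𝓝 f) := by
    refine tendsto_pi_nhds.2 fun x => ?_
    simpa using hf x
  exact ⟨continuousLinearMapOfTendsto _ hlim, hf⟩

theorem UnconditionalSchauderBasis.ext_coord (e : UnconditionalSchauderBasis ℕ 𝕜 E) {x y : E}
    (h : ∀ n, e.coord n x = e.coord n y) : x = y := by
  have h1 := e.expansion x
  simp_rw [h] at h1
  exact h1.unique (e.expansion y)

/-- The backward and forward shifts along `m ↦ 2 * m + 1` act boundedly on a space with a
sub-symmetric basis. -/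
theorem IsSubsymmetric.exists_shifts [CompleteSpace E] {e : UnconditionalSchauderBasis ℕ 𝕜 E}
    (he : IsSubsymmetric e) : ∃ B R : E →L[𝕜] E,
      (∀ x m, e.coord m (B x) = e.coord (2 * m + 1) x) ∧
      (∀ x m, e.coord (2 * m + 1) (R x) = e.coord m x) ∧ ∀ x m, e.coord (2 * m) (R x) = 0 := by
  have hφ : StrictMono fun m : ℕ => 2 * m + 1 := fun a b hab => by dsimp only; omega
  have hequiv := he _ hφ
  obtain ⟨B, hB⟩ := exists_clm_of_tendsto_series (fun n => e.coord (2 * n + 1)) (fun n => e n)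
    fun x => by
      refine (hequiv fun n => e.coord (2 * n + 1) x).2 ?_
      exact ⟨_, ((e.expansion x).summable.comp_injective hφ.injective).hasSum.tendsto_sum_nat⟩
  obtain ⟨R, hR⟩ := exists_clm_of_tendsto_series (fun n => e.coord n) (fun n => e (2 * n + 1))
    fun x => (hequiv fun n => e.coord n x).1 ⟨_, (e.expansion x).tendsto_sum_nat⟩
  have hcoord : ∀ (a : ℕ → 𝕜) (ψ : ℕ → ℕ) (z : E), Function.Injective ψ →
      Tendsto (fun N => ∑ n ∈ Finset.range N, a n • e (ψ n)) atTop (𝓝 z) →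
      ∀ m, e.coord (ψ m) z = a m := by
    intro a ψ z hψ hz m
    have h1 := ((e.coord (ψ m)).continuous.tendsto z).comp hz
    refine tendsto_nhds_unique h1 (tendsto_const_nhds.congr' ?_)
    filter_upwards [eventually_gt_atTop m] with N hN
    simp [e.ortho, Pi.single_apply, hψ.eq_iff, hN]
  refine ⟨B, R, fun x m => hcoord _ id _ Function.injective_id (hB x) m,
    fun x m => hcoord _ _ _ hφ.injective (hR x) m, fun x m => ?_⟩
  have h1 := ((e.coord (2 * m)).continuous.tendsto (R x)).comp (hR x)
  refine tendsto_nhds_unique h1 (tendsto_const_nhds.congr fun N => ?_)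
  have h2 : ∀ n, 2 * m ≠ 2 * n + 1 := fun n => by omega
  simp [e.ortho, h2]

theorem exists_ne_zero_summable_norm_smul (u : ℕ → E) :
    ∃ ε : ℕ → 𝕜, (∀ i, ε i ≠ 0) ∧ Summable fun i => ‖ε i • u i‖ := by
  have hpos : ∀ i, 0 < 1 + ‖u i‖ := fun i => by positivity
  refine ⟨fun i => (((1 / 2) ^ i / (1 + ‖u i‖) : ℝ) : 𝕜), fun i => ?_, ?_⟩
  · exact RCLike.ofReal_ne_zero.2 (div_pos (by positivity) (hpos i)).ne'
  · refine Summable.of_nonneg_of_le (fun i => norm_nonneg _) (fun i => ?_) summable_geometric_two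
    rw [norm_smul, RCLike.norm_ofReal, abs_of_nonneg (div_nonneg (by positivity) (hpos i).le),
      div_mul_eq_mul_div, div_le_iff₀ (hpos i)]
    gcongr
    linarith

end Shifts

/-! ### The universal operator -/

/-- The universal operator, with the complemented copy of `E` given by an embedding `J` and a left
inverse `Q` of it, so that `Z` is the sum of `J E` and `ker Q`. -/
theorem exists_isUniversal_of_retract {𝕜 : Type u} [RCLike 𝕜] {Z : Type w} [NormedAddCommGroup Z]
    [NormedSpace 𝕜 Z] [CompleteSpace Z] [SecondCountableTopology Z] [MeasurableSpace Z]
    [BorelSpace Z] {E : Type t} [NormedAddCommGroup E] [NormedSpace 𝕜 E] [CompleteSpace E]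
    {e : UnconditionalSchauderBasis ℕ 𝕜 E} (he : IsSubsymmetric e) (J : E →L[𝕜] Z) (Q : Z →L[𝕜] E)
    (hQJ : ∀ x, Q (J x) = x) : ∃ A : Z →L[𝕜] Z, IsUniversalForErgodicSystems.{v} A := by
  obtain ⟨B, R, hB, hR, hR0⟩ := he.exists_shifts
  have he1 : ∀ i j, e.coord i (e j) = if i = j then 1 else 0 := fun i j => by
    rw [e.ortho]
    simp [Pi.single_apply]
  have hBR : ∀ x, B (R x) = x := fun x => e.ext_coord fun m => by rw [hB, hR]
  have hRe : ∀ m, R (e m) = e (2 * m + 1) := fun m => e.ext_coord fun n => by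
    rcases Nat.even_or_odd' n with ⟨i, rfl | rfl⟩
    · rw [hR0, he1, if_neg (by omega)]
    · rw [hR, he1, he1]; simp
  have hBe : ∀ m, B (e (2 * m)) = 0 := fun m => e.ext_coord fun n => by
    rw [hB, he1, if_neg (by omega), map_zero]
  -- The scaled forward shift `S`, a contraction of norm at most `1 / 2`.
  set r : ℝ := 2 * (1 + ‖R‖) with hr
  have hr0 : 0 < r := by positivity
  have hr𝕜 : (r : 𝕜) ≠ 0 := RCLike.ofReal_ne_zero.2 hr0.ne'
  set S : E →L[𝕜] E := (r : 𝕜)⁻¹ • R with hS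
  have hSx : ∀ x, S x = (r : 𝕜)⁻¹ • R x := fun x => rfl
  have hSn : ∀ x, ‖S x‖ₑ ≤ ‖x‖ₑ * 2⁻¹ := fun x => by
    have h1 : ‖S x‖ ≤ ‖x‖ * 2⁻¹ := by
      rw [hSx, norm_smul, norm_inv, RCLike.norm_ofReal, abs_of_pos hr0, inv_mul_le_iff₀ hr0]
      calc ‖R x‖ ≤ ‖R‖ * ‖x‖ := R.le_opNorm x
        _ ≤ (1 + ‖R‖) * ‖x‖ := by gcongr; linarith
        _ = r * (‖x‖ * 2⁻¹) := by rw [hr]; ring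
    have h2 := ENNReal.ofReal_le_ofReal h1
    rwa [ENNReal.ofReal_mul (norm_nonneg _), ofReal_norm, ofReal_norm,
      ENNReal.ofReal_inv_of_pos (by norm_num), ENNReal.ofReal_ofNat] at h2
  have hSpow : ∀ x n, ‖S^[n] x‖ₑ ≤ ‖x‖ₑ * 2⁻¹ ^ n := fun x n => by
    induction n with
    | zero => simp
    | succ n ih =>
      rw [Function.iterate_succ_apply', pow_succ, ← mul_assoc]
      exact (hSn _).trans (mul_le_mul' ih le_rfl)
  have hcS : ∀ x m, e.coord (2 * m) (S x) = 0 := fun x m => by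
    rw [hSx, map_smul, hR0, smul_zero]
  -- A dense sequence in `ker Q`, and the nuclear operator mapping `J (e (4 * i + 2))` into it.
  set K : Submodule 𝕜 Z := LinearMap.ker (Q : Z →ₗ[𝕜] E) with hK
  set x : ℕ → Z := fun i => (TopologicalSpace.denseSeq K i : Z) with hx
  have hQx : ∀ i, Q (x i) = 0 := fun i => (TopologicalSpace.denseSeq K i).2
  set q : ℕ → Z →L[𝕜] Z := fun i => ((e.coord (4 * i + 2)).comp Q).smulRight (x i) with hq
  obtain ⟨ε, hε, hεs⟩ := exists_ne_zero_summable_norm_smul (𝕜 := 𝕜) q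
  set P : Z →L[𝕜] Z := ∑' i, ε i • q i with hP
  have hPz : ∀ z, P z = ∑' i, ε i • e.coord (4 * i + 2) (Q z) • x i := fun z => by
    have := (ContinuousLinearMap.apply 𝕜 Z z).map_tsum hεs.of_norm
    simpa [hP, hq] using this
  have hP0 : ∀ z, (∀ i, e.coord (4 * i + 2) (Q z) = 0) → P z = 0 := fun z hz => by
    rw [hPz]; simp [hz]
  have hPe : ∀ i, P (J (e (4 * i + 2))) = ε i • x i := fun i => by
    rw [hPz, tsum_eq_single i]
    · rw [hQJ, he1, if_pos rfl, one_smul]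
    · intro j hj
      rw [hQJ, he1, if_neg (by omega), zero_smul, smul_zero]
  set A : Z →L[𝕜] Z := (r : 𝕜) • (J.comp (B.comp Q)) + P with hA
  have hAz : ∀ z, A z = (r : 𝕜) • J (B (Q z)) + P z := fun z => rfl
  have hAS : ∀ y, A (J (S y)) = J y := fun y => by
    rw [hAz, hP0, hQJ, hSx, map_smul, hBR, map_smul, smul_inv_smul₀ hr𝕜, add_zero]
    intro i
    rw [hQJ, show 4 * i + 2 = 2 * (2 * i + 1) by ring, hcS]
  have hA0 : ∀ y, B y = 0 → (∀ i, e.coord (4 * i + 2) y = 0) → A (J y) = 0 := fun y h1 h2 => by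
    rw [hAz, hQJ, h1, map_zero, smul_zero, zero_add, hP0]
    simpa [hQJ] using h2
  set θ : ℕ → Z →L[𝕜] 𝕜 := fun i => (e.coord (4 * i)).comp Q with hθ
  have hθJ : ∀ i y, θ i (J y) = e.coord (4 * i) y := fun i y => by
    simp [hθ, hQJ]
  have hθS : ∀ i n y, θ i (J (S^[n + 1] y)) = 0 := fun i n y => by
    rw [hθJ, Function.iterate_succ_apply', show 4 * i = 2 * (2 * i) by ring, hcS]
  have hJb : ∀ y n, ‖J (S^[n] y)‖ₑ ≤ (‖J‖₊ * ‖y‖₊ : ℝ≥0) * 2⁻¹ ^ n := fun y n => by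
    rw [ENNReal.coe_mul, mul_assoc]
    exact (J.le_opENorm _).trans (mul_le_mul' le_rfl (hSpow y n))
  -- Backward orbits starting in `J E`.
  have horb1 : ∀ j, (fun n => J (S^[n] (e (4 * j)))) ∈ backwardOrbits A θ := fun j => by
    refine ⟨⟨?_, fun n => ?_⟩, ⟨_, hJb _⟩, fun i n => hθS i n _, ?_⟩
    · refine hA0 _ ?_ fun i => ?_
      · rw [Function.iterate_zero_apply, show 4 * j = 2 * (2 * j) by ring, hBe]
      · rw [Function.iterate_zero_apply, he1, if_neg (by omega)]
    · simp only [Function.iterate_succ_apply', hAS]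
    · filter_upwards [eventually_gt_atTop j] with i hi
      rw [Function.iterate_zero_apply, hθJ, he1, if_neg (by omega)]
  -- Backward orbits starting in `ker Q`.
  have horb2 : ∀ j, (fun n => Nat.casesOn n (ε j • x j) fun n => J (S^[n] (e (4 * j + 2)))) ∈
      backwardOrbits A θ := fun j => by
    have hθx : ∀ i, θ i (ε j • x j) = 0 := fun i => by simp [hθ, hQx]
    refine ⟨⟨?_, fun n => ?_⟩, ⟨‖ε j • x j‖₊ + 2 * (‖J‖₊ * ‖e (4 * j + 2)‖₊), fun n => ?_⟩,
      fun i n => ?_, Eventually.of_forall hθx⟩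
    · change A (ε j • x j) = 0
      rw [map_smul, hAz, hQx, hP0 _ (by simp [hQx])]
      simp
    · cases n with
      | zero =>
        change A (J (e (4 * j + 2))) = ε j • x j
        rw [hAz, hPe, hQJ, show 4 * j + 2 = 2 * (2 * j + 1) by ring, hBe]
        simp
      | succ n =>
        change A (J (S^[n + 1] (e (4 * j + 2)))) = J (S^[n] (e (4 * j + 2)))
        rw [Function.iterate_succ_apply', hAS]
    · cases n with
      | zero =>
        rw [pow_zero, mul_one]
        exact ENNReal.coe_le_coe.2 le_self_add
      | succ n =>
        refine (hJb (e (4 * j + 2)) n).trans ?_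
        rw [pow_succ', ← mul_assoc, ENNReal.coe_add, add_mul, ENNReal.coe_mul (x := 2),
          ENNReal.coe_ofNat, mul_right_comm 2, ENNReal.mul_inv_cancel (by simp) (by simp), one_mul]
        rw [add_mul]
        exact le_add_self
    · cases n with
      | zero =>
        change θ i (J (e (4 * j + 2))) = 0
        rw [hθJ, he1, if_neg (by omega)]
      | succ n => exact hθS i n _
  -- The backward orbit used for the perturbation, with an infinitely supported initial vector.
  obtain ⟨δ, hδ, hδs⟩ := exists_ne_zero_summable_norm_smul (𝕜 := 𝕜) fun i => e (4 * i)
  set y : E := ∑' i, δ i • e (4 * i) with hy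
  have hyc : ∀ n, e.coord n y = ∑' i, δ i * (if n = 4 * i then 1 else 0) := fun n => by
    rw [hy, (e.coord n).map_tsum hδs.of_norm]
    simp [he1]
  have hyc' : ∀ n, (∀ i, n ≠ 4 * i) → e.coord n y = 0 := fun n hn => by
    rw [hyc]; simp [hn]
  have hBy : B y = 0 := e.ext_coord fun n => by
    rw [hB, hyc' _ (by omega), map_zero]
  refine ⟨A, isUniversalForErgodicSystems_of_dense_span (θ := θ) (w := fun n => J (S^[n] y))
    (hA0 _ hBy fun i => hyc' _ (by omega)) (fun n => ?_) (hJb y) (fun i n => hθS i n y)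
    (fun i => ?_) ?_⟩
  · rw [Function.iterate_succ_apply', hAS]
  · rw [Function.iterate_zero_apply, hθJ, hyc, tsum_eq_single i]
    · simpa using hδ i
    · intro j hj
      rw [if_neg (by omega), mul_zero]
  -- Every `e m` is a multiple of some `S^[n] (e j)` with `j` even.
  have hpre : ∀ m, ∃ j n : ℕ, ∃ c : 𝕜, e m = c • S^[n] (e (2 * j)) := by
    intro m
    induction m using Nat.strong_induction_on with
    | _ m ih =>
      rcases Nat.even_or_odd' m with ⟨i, rfl | rfl⟩
      · exact ⟨i, 0, 1, by simp⟩
      · obtain ⟨j, n, c, hc⟩ := ih i (by omega)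
        refine ⟨j, n + 1, c * r, ?_⟩
        rw [Function.iterate_succ_apply', hSx, mul_smul, smul_inv_smul₀ hr𝕜, ← map_smul, ← hc, hRe]
  set V := (Submodule.span 𝕜 {z | ∃ ζ ∈ backwardOrbits A θ, ∃ n, ζ n = z}) with hV
  have hVorb : ∀ ζ ∈ backwardOrbits A θ, ∀ n, ζ n ∈ V.topologicalClosure := fun ζ hζ n =>
    V.le_topologicalClosure (Submodule.subset_span ⟨ζ, hζ, n, rfl⟩)
  have hVe : ∀ m, J (e m) ∈ V.topologicalClosure := fun m => by
    obtain ⟨j, n, c, hc⟩ := hpre m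
    rw [hc, map_smul]
    refine Submodule.smul_mem _ _ ?_
    rcases Nat.even_or_odd' j with ⟨i, rfl | rfl⟩
    · have := hVorb _ (horb1 i) n
      rwa [show 4 * i = 2 * (2 * i) by ring] at this
    · have := hVorb _ (horb2 i) (n + 1)
      rwa [show 4 * i + 2 = 2 * (2 * i + 1) by ring] at this
  have hVJ : ∀ u, J u ∈ V.topologicalClosure := fun u => by
    refine V.isClosed_topologicalClosure.mem_of_tendsto
      ((J.continuous.tendsto u).comp (e.expansion u).tendsto_sum_nat) (Eventually.of_forall ?_)
    intro n
    simp only [Function.comp_apply, map_sum, map_smul]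
    exact Submodule.sum_mem _ fun i _ => Submodule.smul_mem _ _ (hVe i)
  have hVx : ∀ i, x i ∈ V.topologicalClosure := fun i => by
    have h1 : ε i • x i ∈ V.topologicalClosure := hVorb _ (horb2 i) 0
    have h2 := Submodule.smul_mem _ (ε i)⁻¹ h1
    rwa [inv_smul_smul₀ (hε i)] at h2
  have hVK : ∀ z ∈ K, z ∈ V.topologicalClosure := fun z hz => by
    have h1 : IsClosed ((↑) ⁻¹' (V.topologicalClosure : Set Z) : Set K) :=
      V.isClosed_topologicalClosure.preimage continuous_subtype_val
    have h2 : closure (Set.range (TopologicalSpace.denseSeq K)) ⊆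
        ((↑) ⁻¹' (V.topologicalClosure : Set Z) : Set K) :=
      closure_minimal (by rintro _ ⟨i, rfl⟩; exact hVx i) h1
    exact h2 (TopologicalSpace.denseRange_denseSeq K ⟨z, hz⟩)
  intro z
  have h1 : z - J (Q z) ∈ K := by
    change Q (z - J (Q z)) = 0
    rw [map_sub, hQJ, sub_self]
  have h2 := Submodule.add_mem _ (hVK _ h1) (hVJ (Q z))
  rwa [sub_add_cancel] at h2

theorem theorem1p4 {𝕜 : Type u} [RCLike 𝕜]
    (Z : Type w) [NormedAddCommGroup Z] [NormedSpace 𝕜 Z] [CompleteSpace Z]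
    [TopologicalSpace.SeparableSpace Z] [MeasurableSpace Z] [BorelSpace Z]
    (hZ : ¬ FiniteDimensional 𝕜 Z)
    (E : Type t) [NormedAddCommGroup E] [NormedSpace 𝕜 E] [CompleteSpace E]
    (hE : HasSubsymmetricBasis 𝕜 E) (hZE : ContainsComplementedCopy 𝕜 Z E) :
    ∃ A : Z →L[𝕜] Z, IsUniversalForErgodicSystems.{v} A := by
  have : SecondCountableTopology Z := UniformSpace.secondCountable_of_separable Z
  obtain ⟨e, he⟩ := hE
  obtain ⟨W, ⟨p, hp⟩, ⟨f⟩⟩ := hZE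
  refine exists_isUniversal_of_retract he (W.subtypeL.comp (f.symm : E →L[𝕜] W))
    ((f : W →L[𝕜] E).comp p) fun x => ?_
  simp [hp]
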